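/- Let $\rho>0$ and let $H$ be regularly varying at $0$ with index $-\rho$, i.e. $H$ is positive and measurable on some interval $(0,a]$ and $H(tx)/H(x)\to t^{-\rho}$ as $x\to0^+$ for every $t>0$. Let $A,B$ be nonnegative random variables, possibly dependent, whose $(\rho,H)$-local dependence measure (LDM) exists; that is, for every $y\ge 0$ the limit $$g(y)=\lim_{\varepsilon\to0^+}\frac{-\log \mathbb P(\varepsilon A y+B<\varepsilon)}{H(\varepsilon)}\in[0,\infty]$$ exists (with $-\log 0=\infty$). Put $$\lambda^*=\inf_{y>1}\frac{y^\rho}{y^\rho-1}\,g(y)\in[0,\infty].$$ Assume that either $\lambda^*=0$, or $\mathbb P(B=0)<1$ and $g$ is not identically zero on $(0,1)$. (The last two conditions hold, for instance, whenever $\lim_{y\to0^+}g(y)>0$, in particular whenever $g(0)>0$.) Let $X$ be any nonnegative random variable that solves $X\stackrel{d}{=}AX+B$; that is, copies of $X$ and of the pair $(A,B)$ can be constructed on one probability space so that $X$ is independent of $(A,B)$ and $X\stackrel{d}{=}AX+B$. Then $X$ is an ${\rm IED}^\rho_H(\lambda^*)$ random variable, i.e. $$\lim_{\varepsilon\to0^+}\frac{-\log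 \mathbb P(X<\varepsilon)}{H(\varepsilon)}=\lambda^* ,$$ including the cases $\lambda^*=0$ and $\lambda^*=\infty$. In particular, if $0<\lambda^*<\infty$, then $-\log\mathbb P(X<\varepsilon)\sim\lambda^*H(\varepsilon)$ as $\varepsilon\to0^+$. -/

import Mathlib

open MeasureTheory ProbabilityTheory Filter Topology
open scoped NNReal ENNReal

/-- `H` is regularly varying at `0` (from the right) with index `α`: near `0` it is positive and
measurable, and `H (t x) / H x → t ^ α` as `x → 0+` for every `t > 0`.
Only the values of `H` near `0` on the right matter. -/
structure IsRegularlyVaryingAtZero (H : ℝ → ℝ) (α : ℝ) : Prop where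
  pos_measurable : ∃ a : ℝ, 0 < a ∧ (∀ x ∈ Set.Ioc 0 a, 0 < H x) ∧
    Measurable ((Set.Ioc 0 a).domRestrict H)
  tendsto_ratio : ∀ t : ℝ, 0 < t →
    Tendsto (fun x : ℝ => H (t * x) / H x) (𝓝[>] 0) (𝓝 (t ^ α))

/-- `X` is an IED random variable (inverse exponential decay of the left tail) of degree `ρ`,
with rate function `H` and constant `l ∈ [0, ∞]`: `X` is nonnegative and
`- log P (X < x) / H x → l` as `x → 0+`, where `- log 0 = ∞`. -/
structure IsIED {Ω : Type*} [MeasurableSpace Ω] (P : Measure Ω) (ρ : ℝ) (H : ℝ → ℝ) (l : ℝ≥0∞)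
    (X : Ω → ℝ) : Prop where
  rho_pos : 0 < ρ
  regVar : IsRegularlyVaryingAtZero H (-ρ)
  aemeasurable : AEMeasurable X P
  nonneg : ∀ᵐ ω ∂P, 0 ≤ X ω
  tendsto_left_tail : Tendsto (fun x : ℝ => -ENNReal.log (P {ω | X ω < x}) / (H x : EReal))
    (𝓝[>] 0) (𝓝 (l : EReal))

/-- `g : [0, ∞) → [0, ∞]` is the `(ρ, H)`-local dependence measure of the pair `(A, B)` of
nonnegative random variables:
`g y = lim_{ε → 0+} - log P (ε A y + B < ε) / H ε` for every `y ≥ 0`, where `- log 0 = ∞`. -/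
structure IsLDM {Ω : Type*} [MeasurableSpace Ω] (P : Measure Ω) (ρ : ℝ) (H : ℝ → ℝ)
    (A B : Ω → ℝ) (g : ℝ≥0 → ℝ≥0∞) : Prop where
  rho_pos : 0 < ρ
  regVar : IsRegularlyVaryingAtZero H (-ρ)
  aemeasurable_A : AEMeasurable A P
  aemeasurable_B : AEMeasurable B P
  nonneg_A : ∀ᵐ ω ∂P, 0 ≤ A ω
  nonneg_B : ∀ᵐ ω ∂P, 0 ≤ B ω
  tendsto_joint : ∀ y : ℝ≥0,
    Tendsto (fun ε : ℝ => -ENNReal.log (P {ω | ε * A ω * (y : ℝ) + B ω < ε}) / (H ε : EReal))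
      (𝓝[>] 0) (𝓝 (g y : EReal))

/-- The number `λ* = inf_{y > 1} (y ^ ρ / (y ^ ρ - 1)) g y` in `[0, ∞]`. -/
noncomputable def lambdaStar (ρ : ℝ) (g : ℝ≥0 → ℝ≥0∞) : ℝ≥0∞ :=
  ⨅ (y : ℝ≥0) (_ : 1 < y), ENNReal.ofReal ((y : ℝ) ^ ρ / ((y : ℝ) ^ ρ - 1)) * g y

/-- The real random variable `X` is a solution to `X =ᵈ A X + B`: copies of `X` and of the pair
`(A, B)` can be constructed on one probability space so that `X` is independent of `(A, B)` and
`X` and `A X + B` have the same law. (The space may be taken in `Type`, since three real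
random variables can always be realized on `ℝ × ℝ × ℝ`.) -/
def IsSolutionSFPE {Ω Ω' : Type*} [MeasurableSpace Ω] [MeasurableSpace Ω']
    (P : Measure Ω) (A B : Ω → ℝ) (P' : Measure Ω') (X : Ω' → ℝ) : Prop :=
  ∃ (S : Type) (_ : MeasurableSpace S) (Q : Measure S) (X₁ A₁ B₁ : S → ℝ),
    IsProbabilityMeasure Q ∧
    IdentDistrib X₁ X Q P' ∧
    IdentDistrib (fun s => (A₁ s, B₁ s)) (fun ω => (A ω, B ω)) Q P ∧
    IndepFun X₁ (fun s => (A₁ s, B₁ s)) Q ∧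
    IdentDistrib X₁ (fun s => A₁ s * X₁ s + B₁ s) Q Q

/-! Write p(ε) = P(X < ε) and q_y(ε) = P(εAy + B < ε). Independence gives p(yε) q_y(ε) ≤ p(ε). If p
has rate γ, regular variation gives the left side rate γ y^(-ρ) + g(y), so rate γ reproduces itself
once g(y) ≤ γ(1 - y^(-ρ)) for some y > 1; optimising over y yields λ*. Iterating this in
`exists_mul_exp_le_of_mul_le` bounds p from below.

The upper bound is a bootstrap. Let l be the supremum of the rates known for p. The part of {AX + B
< ε} with X/ε near y has rate at least about l y^(-ρ) + g(y). If 0 < l < λ*, this can be made to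
exceed l near every y: for y < 1 since y^(-ρ) > 1, for y > 1 since g(y) ≥ λ*(1 - y^(-ρ)), and at y =
1 since g is positive somewhere on (0,1). Compactness leaves finitely many pieces, so l improves
(`exists_rate_gt`), a contradiction. The start l > 0 is `exists_pos_rate`, which needs B not a.s.
zero. Constant factors are harmless because H → ∞. -/

/-! ### Regular variation at 0 with negative index -/

namespace IsRegularlyVaryingAtZero

variable {H : ℝ → ℝ} {ρ : ℝ}

lemma eventually_pos {α : ℝ} (h : IsRegularlyVaryingAtZero H α) : ∀ᶠ x in 𝓝[>] (0 : ℝ), 0 < H x := by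
  obtain ⟨a, ha, hpos, -⟩ := h.pos_measurable
  filter_upwards [Ioc_mem_nhdsGT ha] with x hx using hpos x hx

lemma eventually_le_mul {α : ℝ} (h : IsRegularlyVaryingAtZero H α) {t c : ℝ} (ht : 0 < t)
    (hc : t ^ α < c) : ∀ᶠ x in 𝓝[>] (0 : ℝ), H (t * x) ≤ c * H x := by
  filter_upwards [h.eventually_pos, (h.tendsto_ratio t ht).eventually_lt_const hc] with x hx hx'
  exact ((div_lt_iff₀ hx).1 hx').le

lemma eventually_mul_le {α : ℝ} (h : IsRegularlyVaryingAtZero H α) {t c : ℝ} (ht : 0 < t)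
    (hc : c < t ^ α) : ∀ᶠ x in 𝓝[>] (0 : ℝ), c * H x ≤ H (t * x) := by
  filter_upwards [h.eventually_pos, (h.tendsto_ratio t ht).eventually_const_lt hc] with x hx hx'
  exact ((lt_div_iff₀ hx).1 hx').le

lemma tendsto_exp_neg_natCast_add (s : ℝ) :
    Tendsto (fun k : ℕ => Real.exp (-(k + s))) atTop (𝓝[>] (0 : ℝ)) := by
  refine tendsto_nhdsWithin_iff.2 ⟨?_, Eventually.of_forall fun k => Real.exp_pos _⟩
  exact Real.tendsto_exp_neg_atTop_nhds_zero.comp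
    (tendsto_atTop_add_const_right _ _ tendsto_natCast_atTop_atTop)

/-- A function regularly varying at `0` with negative index tends to `∞` along geometric
sequences. -/
lemma tendsto_exp_neg_natCast_atTop (hρ : 0 < ρ) (h : IsRegularlyVaryingAtZero H (-ρ)) (s : ℝ) :
    Tendsto (fun k : ℕ => H (Real.exp (-(k + s)))) atTop atTop := by
  have h1 : (1 : ℝ) < Real.exp (-1) ^ (-ρ) := by
    rw [← Real.exp_mul]; exact Real.one_lt_exp_iff.2 (by linarith)
  obtain ⟨c, hc1, hc⟩ := exists_between h1
  have hev := (tendsto_exp_neg_natCast_add s).eventually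
    (h.eventually_pos.and (h.eventually_mul_le (Real.exp_pos (-1)) hc))
  obtain ⟨N, hN⟩ := eventually_atTop.1 hev
  rw [← tendsto_add_atTop_iff_nat N]
  refine tendsto_atTop_of_geom_le (hN _ (by omega)).1 hc1 fun n => ?_
  have := (hN (n + N) (by omega)).2
  rw [← Real.exp_add] at this
  refine this.trans_eq ?_
  push_cast; ring_nf

/-- A function regularly varying at `0` with negative index tends to `∞` at `0+`. -/
theorem tendsto_atTop (hρ : 0 < ρ) (h : IsRegularlyVaryingAtZero H (-ρ)) :
    Tendsto H (𝓝[>] 0) atTop := by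
  obtain ⟨a, ha, hpos, hmeas⟩ := h.pos_measurable
  -- `H` is measurable only near 0; a globally measurable extension makes the sets `W n` below
  -- measurable.
  obtain ⟨F, hF, hFH⟩ : ∃ F : ℝ → ℝ, Measurable F ∧ ∀ x ∈ Set.Ioc 0 a, F x = H x := by
    obtain ⟨F, hF, hFH⟩ :=
      (MeasurableEmbedding.subtype_coe measurableSet_Ioc).exists_measurable_extend hmeas
        fun _ => ⟨0⟩
    exact ⟨F, hF, fun x hx => congrFun hFH ⟨x, hx⟩⟩
  have hFH' : ∀ᶠ x in 𝓝[>] (0 : ℝ), F x = H x := by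
    filter_upwards [Ioc_mem_nhdsGT ha] with x hx using hFH x hx
  by_contra hcon
  rw [Filter.tendsto_atTop] at hcon
  push Not at hcon
  obtain ⟨M, hM⟩ := hcon
  obtain ⟨x, hx0, hxM⟩ := exists_seq_forall_of_frequently (by simpa using hM)
  have hxpos : ∀ᶠ m in atTop, 0 < x m := hx0.eventually self_mem_nhdsWithin
  -- For s in [0,1] the limiting ratio of H(e^(-s) x) to H(x) is e^(ρs) ≤ e^ρ; the extra 1 makes the
  -- bound strict. `V n` increases to [0,2] and `W n` to [0,1], so their lengths eventually add up
  -- to more than 2.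
  set M' : ℝ := (Real.exp ρ + 1) * M with hM'
  let V : ℕ → Set ℝ := fun n => Set.Icc 0 2 ∩ {s | ∀ k ≥ n, M' ≤ F (Real.exp (-(k + s)))}
  let W : ℕ → Set ℝ := fun n => Set.Icc 0 1 ∩ {s | ∀ m ≥ n, F (Real.exp (-s) * x m) < M'}
  have hWm : ∀ n, MeasurableSet (W n) := by
    intro n
    refine measurableSet_Icc.inter ?_
    simp only [Set.ofPred_forall]
    refine MeasurableSet.iInter fun m => MeasurableSet.iInter fun _ => ?_
    exact measurableSet_lt (by fun_prop) measurable_const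
  have hVmono : Monotone V := fun i j hij s hs => ⟨hs.1, fun k hk => hs.2 k (hij.trans hk)⟩
  have hWmono : Monotone W := fun i j hij s hs => ⟨hs.1, fun k hk => hs.2 k (hij.trans hk)⟩
  have hVU : ⋃ n, V n = Set.Icc 0 2 := by
    refine Set.Subset.antisymm (Set.iUnion_subset fun n => Set.inter_subset_left) fun s hs => ?_
    have h1 := ((tendsto_exp_neg_natCast_atTop hρ h s).eventually_ge_atTop M').and
      ((tendsto_exp_neg_natCast_add s).eventually hFH')
    obtain ⟨n, hn⟩ := eventually_atTop.1 h1
    exact Set.mem_iUnion.2 ⟨n, hs, fun k hk => (hn k hk).2 ▸ (hn k hk).1⟩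
  have hWU : ⋃ n, W n = Set.Icc 0 1 := by
    refine Set.Subset.antisymm (Set.iUnion_subset fun n => Set.inter_subset_left) fun s hs => ?_
    have hsc : Real.exp (-s) ^ (-ρ) < Real.exp ρ + 1 := by
      rw [← Real.exp_mul]
      have : Real.exp (-s * -ρ) ≤ Real.exp ρ := Real.exp_le_exp.2 (by nlinarith [hs.2])
      linarith
    have hs0 : Tendsto (fun y : ℝ => Real.exp (-s) * y) (𝓝[>] 0) (𝓝[>] 0) := by
      refine tendsto_nhdsWithin_iff.2 ⟨?_, ?_⟩
      · refine Tendsto.mono_left ?_ nhdsWithin_le_nhds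
        exact Continuous.tendsto' (by fun_prop) _ _ (by simp)
      · filter_upwards [self_mem_nhdsWithin] with y hy
        exact mul_pos (Real.exp_pos _) hy
    obtain ⟨n, hn⟩ := eventually_atTop.1 (hx0.eventually
      ((h.eventually_le_mul (Real.exp_pos (-s)) hsc).and (hs0.eventually hFH')))
    refine Set.mem_iUnion.2 ⟨n, hs, fun m hm => ?_⟩
    have := (hn m hm).1
    rw [(hn m hm).2]
    exact this.trans_lt (mul_lt_mul_of_pos_left (hxM m) (by positivity))
  have hV2 : Tendsto (fun n => volume (V n)) atTop (𝓝 2) := by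
    have := tendsto_measure_iUnion_atTop (μ := volume) hVmono
    rwa [hVU, Real.volume_Icc, sub_zero, ENNReal.ofReal_ofNat] at this
  have hW1 : Tendsto (fun n => volume (W n)) atTop (𝓝 1) := by
    have := tendsto_measure_iUnion_atTop (μ := volume) hWmono
    rwa [hWU, Real.volume_Icc, sub_zero, ENNReal.ofReal_one] at this
  have hk : Tendsto (fun m => ⌊-Real.log (x m)⌋₊) atTop atTop :=
    tendsto_nat_floor_atTop.comp
      (tendsto_neg_atBot_atTop.comp (Real.tendsto_log_nhdsGT_zero.comp hx0))
  have hsum : Tendsto (fun n => volume (V n) + volume (W n)) atTop (𝓝 (2 + 1)) := hV2.add hW1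
  obtain ⟨N, hN⟩ := (hsum.eventually_const_lt
    (show (2 : ℝ≥0∞) < 2 + 1 by norm_num)).exists
  have hx1 : ∀ᶠ m in atTop, x m ≤ 1 :=
    hx0.eventually (Filter.mem_of_superset (Ioc_mem_nhdsGT one_pos) fun y hy => hy.2)
  obtain ⟨m, hmN, hkm, hm0, hm1⟩ := ((eventually_ge_atTop N).and
    ((hk.eventually_ge_atTop N).and (hxpos.and hx1))).exists
  set r := -Real.log (x m) with hr
  have hr0 : 0 ≤ r := by have := Real.log_nonpos hm0.le hm1; linarith
  set k := ⌊r⌋₊ with hkdef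
  have hk1 : (k : ℝ) ≤ r := Nat.floor_le hr0
  have hk2 : r < k + 1 := Nat.lt_floor_add_one r
  -- With x_m = e^(-r), translating `W N` by the fractional part of r keeps it in [0,2] and makes
  -- both sets evaluate `F` at e^(-(k+s)). There the two conditions contradict each other, so the
  -- sets are disjoint in an interval too short for both.
  let T : Set ℝ := (fun s => s + (-(r - k))) ⁻¹' W N
  have hTm : MeasurableSet T := (hWm N).preimage (by fun_prop)
  have hTv : volume T = volume (W N) := measure_preimage_add_right _ _ _
  have hdisj : Disjoint (V N) T := by
    rw [Set.disjoint_left]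
    rintro s ⟨-, hsV⟩ ⟨-, hsT⟩
    have h1 := hsV k hkm
    have h2 := hsT m hmN
    have h3 : Real.exp (-(s + -(r - k))) * x m = Real.exp (-(k + s)) := by
      rw [← Real.exp_log hm0, ← Real.exp_add]
      congr 1
      rw [show Real.log (x m) = -r by rw [hr]; ring]; ring
    rw [h3] at h2
    exact absurd h1 (not_le.2 h2)
  have hsub : V N ∪ T ⊆ Set.Icc 0 2 := by
    rintro s (hs | hs)
    · exact hs.1
    · have := hs.1
      simp only [Set.mem_Icc] at this ⊢
      constructor <;> linarith
  have hle := measure_mono (μ := volume) hsub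
  rw [measure_union hdisj hTm, hTv, Real.volume_Icc, sub_zero, ENNReal.ofReal_ofNat] at hle
  exact absurd hN (not_lt.2 hle)

/-- Multiplicative constants are negligible on the scale `exp (-γ H)`. -/
lemma eventually_mul_exp_le (hρ : 0 < ρ) (h : IsRegularlyVaryingAtZero H (-ρ)) {γ γ' : ℝ}
    (hγ : γ < γ') (K : ℝ) :
    ∀ᶠ x in 𝓝[>] (0 : ℝ), K * Real.exp (-γ' * H x) ≤ Real.exp (-γ * H x) := by
  have h1 : Tendsto (fun x => Real.exp ((γ' - γ) * H x)) (𝓝[>] 0) atTop :=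
    Real.tendsto_exp_atTop.comp ((h.tendsto_atTop hρ).const_mul_atTop (sub_pos.2 hγ))
  filter_upwards [h1.eventually_ge_atTop K] with x hx
  refine (mul_le_mul_of_nonneg_right hx (Real.exp_pos _).le).trans_eq ?_
  rw [← Real.exp_add]; ring_nf

end IsRegularlyVaryingAtZero

/-! ### Logarithmic limits as exponential bounds -/

lemma coe_le_neg_log_div_iff {p : ℝ≥0∞} {h γ : ℝ} (hh : 0 < h) :
    (γ : EReal) ≤ -ENNReal.log p / (h : EReal) ↔ p ≤ ENNReal.ofReal (Real.exp (-γ * h)) := by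
  rw [EReal.le_div_iff_mul_le (by exact_mod_cast hh) (EReal.coe_ne_top h), EReal.le_neg,
    ← EReal.coe_mul, ← EReal.coe_neg, ← EReal.log_exp ((-(γ * h) : ℝ) : EReal),
    ENNReal.log_le_log_iff, EReal.exp_coe, neg_mul]

lemma neg_log_div_le_coe_iff {p : ℝ≥0∞} {h γ : ℝ} (hh : 0 < h) :
    -ENNReal.log p / (h : EReal) ≤ γ ↔ ENNReal.ofReal (Real.exp (-γ * h)) ≤ p := by
  rw [EReal.div_le_iff_le_mul (by exact_mod_cast hh) (EReal.coe_ne_top h), EReal.neg_le,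
    ← EReal.coe_mul, ← EReal.coe_neg, ← EReal.log_exp ((-(h * γ) : ℝ) : EReal),
    ENNReal.log_le_log_iff, EReal.exp_coe, neg_mul, mul_comm γ]

/-- Convergence of `-log p / H` in terms of exponential bounds for `p`. -/
lemma tendsto_neg_log_div_iff {p : ℝ → ℝ≥0∞} {H : ℝ → ℝ} {l : EReal} {f : Filter ℝ}
    (hH : ∀ᶠ x in f, 0 < H x) :
    Tendsto (fun x => -ENNReal.log (p x) / (H x : EReal)) f (𝓝 l) ↔
      (∀ γ : ℝ, (γ : EReal) < l → ∀ᶠ x in f, p x ≤ ENNReal.ofReal (Real.exp (-γ * H x))) ∧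
      (∀ γ : ℝ, l < (γ : EReal) → ∀ᶠ x in f, ENNReal.ofReal (Real.exp (-γ * H x)) ≤ p x) := by
  rw [tendsto_order]
  refine and_congr ⟨fun h γ hγ => ?_, fun h a ha => ?_⟩ ⟨fun h γ hγ => ?_, fun h a ha => ?_⟩
  · filter_upwards [h γ hγ, hH] with x hx hx' using (coe_le_neg_log_div_iff hx').1 hx.le
  · obtain ⟨γ, h1, h2⟩ := EReal.lt_iff_exists_real_btwn.1 ha
    filter_upwards [h γ h2, hH] with x hx hx'
    exact h1.trans_le ((coe_le_neg_log_div_iff hx').2 hx)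
  · filter_upwards [h γ hγ, hH] with x hx hx' using (neg_log_div_le_coe_iff hx').1 hx.le
  · obtain ⟨γ, h1, h2⟩ := EReal.lt_iff_exists_real_btwn.1 ha
    filter_upwards [h γ h1, hH] with x hx hx'
    exact ((neg_log_div_le_coe_iff hx').2 hx).trans_lt h2

/-! ### Deterministic recursions for tail functions -/

/-- If `p (y ε) q ε ≤ p ε` with `y > 1`, then an exponential lower bound for `q` on the scale `H`
gives one for `p`. -/
lemma exists_mul_exp_le_of_mul_le {p q H : ℝ → ℝ} {ρ y c γ γ' : ℝ}
    (h : IsRegularlyVaryingAtZero H (-ρ)) (hp : Monotone p) (hq : MonotoneOn q (Set.Ioi 0))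
    (hp0 : ∃ ε > 0, 0 < p ε) (hy : 1 < y) (hpq : ∀ ε > 0, p (y * ε) * q ε ≤ p ε)
    (hqH : ∀ᶠ ε in 𝓝[>] (0 : ℝ), Real.exp (-γ' * H ε) ≤ q ε)
    (hγ : 0 ≤ γ) (hc : y ^ (-ρ) < c) (hcγ : γ * c + γ' ≤ γ) :
    ∃ K > 0, ∀ᶠ ε in 𝓝[>] (0 : ℝ), K * Real.exp (-γ * H ε) ≤ p ε := by
  have hy0 : 0 < y := by linarith
  have hev := hqH.and (h.eventually_pos.and (h.eventually_le_mul hy0 hc))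
  obtain ⟨δ, hδ, hδ'⟩ := mem_nhdsGT_iff_exists_Ioo_subset.1 hev
  have hδ0 : 0 < δ := hδ
  have hpow : ∀ ε : ℝ, 0 < ε → ∀ r : ℝ, ∃ n : ℕ, r < y ^ n * ε := fun ε hε r => by
    obtain ⟨n, hn⟩ := pow_unbounded_of_one_lt (r / ε) hy
    exact ⟨n, (div_lt_iff₀ hε).1 hn⟩
  have hqpos : ∀ ε > 0, 0 < q ε := fun ε hε => by
    have hm : min ε (δ / 2) ∈ Set.Ioo 0 δ :=
      ⟨lt_min hε (by linarith), (min_le_right _ _).trans_lt (by linarith)⟩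
    exact (Real.exp_pos _).trans_le ((hδ' hm).1.trans (hq hm.1 hε (min_le_left _ _)))
  have hppos : ∀ ε > 0, 0 < p ε := by
    obtain ⟨ε₀, -, hpε₀⟩ := hp0
    have key : ∀ n : ℕ, ∀ ε > 0, ε₀ < y ^ n * ε → 0 < p ε := by
      intro n
      induction n with
      | zero => intro ε _ h; exact hpε₀.trans_le (hp (by simpa using h.le))
      | succ n ih =>
        intro ε hε h
        have := ih (y * ε) (by positivity) (by rw [pow_succ] at h; linarith)
        exact (mul_pos this (hqpos ε hε)).trans_le (hpq ε hε)
    intro ε hε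
    obtain ⟨n, hn⟩ := hpow ε hε ε₀
    exact key n ε hε hn
  have hK : 0 < p (δ / y) := hppos _ (by positivity)
  refine ⟨p (δ / y), hK, ?_⟩
  -- Here n bounds the number of multiplications by y needed to leave (0, δ). The last point before
  -- leaving is at least δ/y, whence the constant; `hcγ` keeps the exponent at -γ H(ε) in each step.
  have key : ∀ n : ℕ, ∀ ε ∈ Set.Ioo 0 δ, δ < y ^ n * ε →
      p (δ / y) * Real.exp (-γ * H ε) ≤ p ε := by
    intro n
    induction n with
    | zero => intro ε hε h; exact absurd hε.2 (by simpa using h.le)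
    | succ n ih =>
      intro ε hε hn
      obtain ⟨h1, h2, h3⟩ := hδ' hε
      by_cases hyε : y * ε < δ
      · have := ih (y * ε) ⟨by have := hε.1; positivity, hyε⟩ (by rw [pow_succ] at hn; linarith)
        refine le_trans ?_ (hpq ε hε.1)
        refine le_trans ?_ (mul_le_mul this h1 (Real.exp_pos _).le (hppos _ (by
          have := hε.1; positivity)).le)
        rw [mul_assoc, ← Real.exp_add]
        refine mul_le_mul_of_nonneg_left (Real.exp_le_exp.2 ?_) hK.le
        have h4 := mul_le_mul_of_nonneg_left h3 hγ
        have h5 := mul_le_mul_of_nonneg_right hcγ h2.le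
        nlinarith
      · have h4 : p (δ / y) ≤ p ε := hp (by rw [div_le_iff₀ hy0]; linarith)
        refine le_trans (mul_le_of_le_one_right hK.le ?_) h4
        exact Real.exp_le_one_iff.2 (by nlinarith)
  filter_upwards [Ioo_mem_nhdsGT hδ0] with ε hε
  obtain ⟨n, hn⟩ := hpow ε hε.1 δ
  exact key n ε hε hn

/-- If `p ε ≤ c p (y ε) + exp (-γ H ε)` with `c, y < 1`, then `p ε = O (exp (-γ H ε))`. -/
lemma eventually_le_mul_exp_of_le_add {p H : ℝ → ℝ} {ρ y c γ : ℝ} (hρ : 0 < ρ)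
    (h : IsRegularlyVaryingAtZero H (-ρ)) (hp : ∀ ε, p ε ≤ 1) (hy0 : 0 < y) (hy : y < 1)
    (hc0 : 0 ≤ c) (hc : c < 1) (hγ : 0 ≤ γ)
    (hpH : ∀ᶠ ε in 𝓝[>] (0 : ℝ), p ε ≤ c * p (y * ε) + Real.exp (-γ * H ε)) :
    ∀ᶠ ε in 𝓝[>] (0 : ℝ), p ε ≤ (1 - c)⁻¹ * Real.exp (-γ * H ε) := by
  have hy1 : 1 < y ^ (-ρ) := Real.one_lt_rpow_of_pos_of_lt_one_of_neg hy0 hy (by linarith)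
  obtain ⟨δ, hδ, hδ'⟩ := mem_nhdsGT_iff_exists_Ioo_subset.1
    (hpH.and (h.eventually_mul_le hy0 hy1))
  have hδ0 : 0 < δ := hδ
  have hC : c * (1 - c)⁻¹ + 1 = (1 - c)⁻¹ := by
    have : 1 - c ≠ 0 := by linarith
    field_simp; ring
  have hC0 : 0 ≤ (1 - c)⁻¹ := inv_nonneg.2 (by linarith)
  -- Since H(yε) ≥ H(ε), every error term is at most the first one, and they sum like a geometric
  -- series; the remainder c^n vanishes as n → ∞.
  have key : ∀ n : ℕ, ∀ ε ∈ Set.Ioo 0 δ, p ε ≤ c ^ n + (1 - c)⁻¹ * Real.exp (-γ * H ε) := by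
    intro n
    induction n with
    | zero =>
      intro ε _
      have := mul_nonneg hC0 (Real.exp_pos (-γ * H ε)).le
      have := hp ε
      rw [pow_zero]; linarith
    | succ n ih =>
      intro ε hε
      obtain ⟨h1, h2⟩ := hδ' hε
      have h3 := ih (y * ε) ⟨mul_pos hy0 hε.1, by nlinarith [hε.1, hε.2]⟩
      have h4 : Real.exp (-γ * H (y * ε)) ≤ Real.exp (-γ * H ε) :=
        Real.exp_le_exp.2 (by nlinarith)
      calc p ε ≤ c * p (y * ε) + Real.exp (-γ * H ε) := h1
        _ ≤ c * (c ^ n + (1 - c)⁻¹ * Real.exp (-γ * H ε)) + Real.exp (-γ * H ε) := by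
            gcongr; exact h3.trans (by gcongr)
        _ = c ^ (n + 1) + (c * (1 - c)⁻¹ + 1) * Real.exp (-γ * H ε) := by ring
        _ = _ := by rw [hC]
  filter_upwards [Ioo_mem_nhdsGT hδ0] with ε hε
  have hlim : Tendsto (fun n : ℕ => c ^ n + (1 - c)⁻¹ * Real.exp (-γ * H ε)) atTop
      (𝓝 (0 + (1 - c)⁻¹ * Real.exp (-γ * H ε))) :=
    (tendsto_pow_atTop_nhds_zero_of_lt_one hc0 hc).add_const _
  rw [zero_add] at hlim
  exact ge_of_tendsto' hlim fun n => key n ε hε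

/-! ### Splitting the event by the size of X/ε -/

lemma measureReal_mono_ae {S : Type*} [MeasurableSpace S] {Q : Measure S} [IsFiniteMeasure Q]
    {E F : Set S} (h : ∀ᵐ s ∂Q, s ∈ E → s ∈ F) : Q.real E ≤ Q.real F :=
  ENNReal.toReal_mono (measure_ne_top Q F) (measure_mono_ae h)

section

variable {S : Type*} [MeasurableSpace S] {Q : Measure S}
  {X A B : S → ℝ} {H : ℝ → ℝ} {ρ : ℝ}

lemma measureReal_lt_and_lt (hind : IndepFun X (fun s => (A s, B s)) Q) (b ε y : ℝ) :
    Q.real {s | X s < b ∧ ε * A s * y + B s < ε} =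
      Q.real {s | X s < b} * Q.real {s | ε * A s * y + B s < ε} := by
  have := hind.measure_inter_preimage_eq_mul (Set.Iio b) {z : ℝ × ℝ | ε * z.1 * y + z.2 < ε}
    measurableSet_Iio (measurableSet_lt (by fun_prop) (by fun_prop))
  have h2 := congrArg ENNReal.toReal this
  rw [ENNReal.toReal_mul] at h2
  exact h2

/-- A union costs a factor 2, absorbed by lowering the smaller rate slightly while staying above l.
This is the union step of the compactness argument. -/
lemma eventually_measureReal_div_mem_union_le (hρ : 0 < ρ)
    (h : IsRegularlyVaryingAtZero H (-ρ)) {l : ℝ} {T U : Set ℝ}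
    (hT : ∃ μ > l, ∀ᶠ ε in 𝓝[>] (0 : ℝ),
      Q.real {s | X s / ε ∈ T ∧ A s * X s + B s < ε} ≤ Real.exp (-μ * H ε))
    (hU : ∃ μ > l, ∀ᶠ ε in 𝓝[>] (0 : ℝ),
      Q.real {s | X s / ε ∈ U ∧ A s * X s + B s < ε} ≤ Real.exp (-μ * H ε)) :
    ∃ μ > l, ∀ᶠ ε in 𝓝[>] (0 : ℝ),
      Q.real {s | X s / ε ∈ T ∪ U ∧ A s * X s + B s < ε} ≤ Real.exp (-μ * H ε) := by
  obtain ⟨μ, hμ, hT⟩ := hT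
  obtain ⟨ν, hν, hU⟩ := hU
  obtain ⟨κ, hκ, hκ'⟩ := exists_between (lt_min hμ hν)
  refine ⟨κ, hκ, ?_⟩
  filter_upwards [hT, hU, h.eventually_pos, h.eventually_mul_exp_le hρ hκ' 2]
    with ε h1 h2 h3 h4
  have h5 : Real.exp (-μ * H ε) ≤ Real.exp (-(min μ ν) * H ε) :=
    Real.exp_le_exp.2 (by nlinarith [min_le_left μ ν])
  have h6 : Real.exp (-ν * H ε) ≤ Real.exp (-(min μ ν) * H ε) :=
    Real.exp_le_exp.2 (by nlinarith [min_le_right μ ν])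
  have h7 : {s | X s / ε ∈ T ∪ U ∧ A s * X s + B s < ε} =
      {s | X s / ε ∈ T ∧ A s * X s + B s < ε} ∪ {s | X s / ε ∈ U ∧ A s * X s + B s < ε} := by
    ext s; simp [or_and_right]
  rw [h7]
  have := measureReal_union_le (μ := Q) {s | X s / ε ∈ T ∧ A s * X s + B s < ε}
    {s | X s / ε ∈ U ∧ A s * X s + B s < ε}
  linarith

variable [IsProbabilityMeasure Q]

/-- On `{X < y ε}` one may replace `X` by `y ε` in `A X + B`. -/
lemma mul_le_measureReal_affine_lt (hA0 : ∀ᵐ s ∂Q, 0 ≤ A s)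
    (hind : IndepFun X (fun s => (A s, B s)) Q) (y ε : ℝ) :
    Q.real {s | X s < y * ε} * Q.real {s | ε * A s * y + B s < ε} ≤
      Q.real {s | A s * X s + B s < ε} := by
  rw [← measureReal_lt_and_lt hind]
  refine measureReal_mono_ae ?_
  filter_upwards [hA0] with s hs
  rintro ⟨h1, h2⟩
  have := mul_le_mul_of_nonneg_left h1.le hs
  show A s * X s + B s < ε
  linarith

/-- On `{a ≤ X / ε < b}` one may replace `X` by `a ε` in `A X + B`. -/
lemma measureReal_div_mem_and_affine_lt_le (hA0 : ∀ᵐ s ∂Q, 0 ≤ A s)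
    (hind : IndepFun X (fun s => (A s, B s)) Q) {a b ε : ℝ} (hε : 0 < ε) {T : Set ℝ}
    (hT : T ⊆ Set.Ico a b) :
    Q.real {s | X s / ε ∈ T ∧ A s * X s + B s < ε} ≤
      Q.real {s | X s < b * ε} * Q.real {s | ε * A s * a + B s < ε} := by
  rw [← measureReal_lt_and_lt hind]
  refine measureReal_mono_ae ?_
  filter_upwards [hA0] with s hs
  rintro ⟨h1, h2⟩
  obtain ⟨h3, h4⟩ := hT h1
  rw [le_div_iff₀ hε] at h3
  rw [div_lt_iff₀ hε] at h4
  have := mul_le_mul_of_nonneg_left h3 hs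
  exact ⟨h4, by linarith⟩

/-- The part of `{A X + B < ε}` with `X / ε ≥ a` lies in `{ε A a + B < ε}`. -/
lemma measureReal_div_mem_and_affine_lt_le_of_subset_Ici (hA0 : ∀ᵐ s ∂Q, 0 ≤ A s) {a ε : ℝ}
    (hε : 0 < ε) {T : Set ℝ} (hT : T ⊆ Set.Ici a) :
    Q.real {s | X s / ε ∈ T ∧ A s * X s + B s < ε} ≤ Q.real {s | ε * A s * a + B s < ε} := by
  refine measureReal_mono_ae ?_
  filter_upwards [hA0] with s hs
  rintro ⟨h1, h2⟩
  have h3 : a ≤ X s / ε := hT h1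
  rw [le_div_iff₀ hε] at h3
  have := mul_le_mul_of_nonneg_left h3 hs
  show ε * A s * a + B s < ε
  linarith

/-- The local gain: the factor P(X < bε) contributes nearly b^(-ρ) l and the joint factor
contributes γ. -/
lemma eventually_measureReal_div_mem_le (h : IsRegularlyVaryingAtZero H (-ρ))
    (hA0 : ∀ᵐ s ∂Q, 0 ≤ A s) (hind : IndepFun X (fun s => (A s, B s)) Q) {l γ a b : ℝ}
    (hl : 0 < l)
    (hp : ∀ γ < l, ∀ᶠ ε in 𝓝[>] (0 : ℝ), Q.real {s | X s < ε} ≤ Real.exp (-γ * H ε))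
    (hq : ∀ᶠ ε in 𝓝[>] (0 : ℝ), Q.real {s | ε * A s * a + B s < ε} ≤ Real.exp (-γ * H ε))
    (hb : 0 < b) (hlb : l < b ^ (-ρ) * l + γ) {T : Set ℝ} (hT : T ⊆ Set.Ico a b) :
    ∃ μ > l, ∀ᶠ ε in 𝓝[>] (0 : ℝ),
      Q.real {s | X s / ε ∈ T ∧ A s * X s + B s < ε} ≤ Real.exp (-μ * H ε) := by
  have hbρ : 0 < b ^ (-ρ) := Real.rpow_pos_of_pos hb _
  -- One t serves for two losses: the rate l itself need not be attained, and H(bε)/H(ε) only tends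
  -- to b^(-ρ).
  obtain ⟨t, ht0, ht1, ht⟩ : ∃ t : ℝ, 0 < t ∧ t < 1 ∧ l < (t * b ^ (-ρ)) * (t * l) + γ := by
    have hc : ContinuousAt (fun t : ℝ => (t * b ^ (-ρ)) * (t * l) + γ) 1 := by fun_prop
    have h1 := (hc.tendsto.mono_left (nhdsWithin_le_nhds (s := Set.Iio 1))).eventually_const_lt
      (show l < (1 * b ^ (-ρ)) * (1 * l) + γ by linarith)
    obtain ⟨t, h1, h2⟩ := (h1.and (Ioo_mem_nhdsLT one_pos)).exists
    exact ⟨t, h2.1, h2.2, h1⟩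
  refine ⟨_, ht, ?_⟩
  have hbt : Tendsto (fun ε : ℝ => b * ε) (𝓝[>] 0) (𝓝[>] 0) := by
    refine tendsto_nhdsWithin_iff.2 ⟨?_, ?_⟩
    · refine Tendsto.mono_left ?_ nhdsWithin_le_nhds
      exact Continuous.tendsto' (by fun_prop) _ _ (by simp)
    · filter_upwards [self_mem_nhdsWithin] with y hy using mul_pos hb hy
  filter_upwards [self_mem_nhdsWithin, hbt.eventually (hp (t * l) (by nlinarith)), hq,
    h.eventually_mul_le hb (show t * b ^ (-ρ) < b ^ (-ρ) by nlinarith)] with ε hε h1 h2 h3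
  refine (measureReal_div_mem_and_affine_lt_le hA0 hind hε hT).trans ?_
  refine (mul_le_mul h1 h2 measureReal_nonneg (Real.exp_pos _).le).trans ?_
  rw [← Real.exp_add]
  have := mul_le_mul_of_nonneg_left h3 (by positivity : 0 ≤ t * l)
  exact Real.exp_le_exp.2 (by linarith)

/-- An exponential decay rate `l` of the left tail of a solution of `X = A X + B` which is smaller
than `l' ≤ λ*` can be improved. -/
lemma exists_rate_gt (hρ : 0 < ρ) (h : IsRegularlyVaryingAtZero H (-ρ))
    (hA0 : ∀ᵐ s ∂Q, 0 ≤ A s) (hX0 : ∀ᵐ s ∂Q, 0 ≤ X s)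
    (hind : IndepFun X (fun s => (A s, B s)) Q)
    (hfix : ∀ ε, Q.real {s | X s < ε} = Q.real {s | A s * X s + B s < ε}) {l l' a₀ γ₀ : ℝ}
    (hl : 0 < l) (hll' : l < l')
    (hp : ∀ γ < l, ∀ᶠ ε in 𝓝[>] (0 : ℝ), Q.real {s | X s < ε} ≤ Real.exp (-γ * H ε))
    (hq : ∀ a > 1, ∀ γ < l' * (1 - a ^ (-ρ)),
      ∀ᶠ ε in 𝓝[>] (0 : ℝ), Q.real {s | ε * A s * a + B s < ε} ≤ Real.exp (-γ * H ε))
    (ha₀ : 0 < a₀) (ha₀' : a₀ < 1) (hγ₀ : 0 < γ₀)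
    (hq₀ : ∀ᶠ ε in 𝓝[>] (0 : ℝ), Q.real {s | ε * A s * a₀ + B s < ε} ≤ Real.exp (-γ₀ * H ε)) :
    ∃ μ > l, ∀ᶠ ε in 𝓝[>] (0 : ℝ), Q.real {s | X s < ε} ≤ Real.exp (-μ * H ε) := by
  have hl' : 0 < l' := hl.trans hll'
  have hcont : ∀ b : ℝ, 0 < b → ContinuousAt (fun b : ℝ => b ^ (-ρ)) b := fun b hb =>
    Real.continuousAt_rpow_const _ _ (Or.inl hb.ne')
  obtain ⟨M, hM1, hM⟩ : ∃ M : ℝ, 1 < M ∧ l < l' * (1 - M ^ (-ρ)) := by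
    have h1 : Tendsto (fun M : ℝ => l' * (1 - M ^ (-ρ))) atTop (𝓝 (l' * (1 - 0))) :=
      (tendsto_const_nhds.sub (tendsto_rpow_neg_atTop hρ)).const_mul _
    obtain ⟨M, h2, h3⟩ := ((h1.eventually_const_lt (by linarith : l < l' * (1 - 0))).and
      (eventually_gt_atTop 1)).exists
    exact ⟨M, h3, h2⟩
  have hcompact : ∃ μ > l, ∀ᶠ ε in 𝓝[>] (0 : ℝ),
      Q.real {s | X s / ε ∈ Set.Icc 0 M ∧ A s * X s + B s < ε} ≤ Real.exp (-μ * H ε) := by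
    refine isCompact_Icc.induction_on (p := fun T : Set ℝ => ∃ μ > l, ∀ᶠ ε in 𝓝[>] (0 : ℝ),
      Q.real {s | X s / ε ∈ T ∧ A s * X s + B s < ε} ≤ Real.exp (-μ * H ε)) ?_ ?_ ?_ ?_
    · exact ⟨l + 1, by linarith, Eventually.of_forall fun ε => by simp [(Real.exp_pos _).le]⟩
    · rintro T U hTU ⟨μ, hμ, hU⟩
      refine ⟨μ, hμ, hU.mono fun ε hε => le_trans (measureReal_mono ?_) hε⟩
      exact fun s hs => ⟨hTU hs.1, hs.2⟩
    · exact fun T U hT hU => eventually_measureReal_div_mem_union_le hρ h hT hU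
    · intro y hy
      rcases lt_trichotomy y 1 with hy1 | rfl | hy1
      -- Below 1 the factor P(X < bε) alone beats l; the joint factor is bounded by 1, that is, γ =
      -- 0.
      · obtain ⟨b, hb, hb1⟩ := exists_between hy1
        have hb0 : 0 < b := hy.1.trans_lt hb
        refine ⟨Set.Icc 0 M ∩ Set.Iio b,
          inter_mem_nhdsWithin _ (Iio_mem_nhds hb), ?_⟩
        refine eventually_measureReal_div_mem_le h hA0 hind hl hp (γ := 0) (a := 0) (b := b)
          ?_ hb0 ?_ fun z hz => ⟨hz.1.1, hz.2⟩
        · refine Eventually.of_forall fun ε => ?_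
          simp [measureReal_le_one]
        · have := Real.one_lt_rpow_of_pos_of_lt_one_of_neg hb0 hb1 (neg_lt_zero.2 hρ)
          nlinarith
      -- At 1 a right endpoint b > 1 is unavoidable; for b close to 1 its loss is less than the gain
      -- γ₀ available from a₀ < 1.
      · have h1 : ContinuousAt (fun b : ℝ => b ^ (-ρ) * l + γ₀) 1 :=
          ((hcont 1 one_pos).mul_const l).add_const γ₀
        have h2 := (h1.tendsto.mono_left (nhdsWithin_le_nhds (s := Set.Ioi 1))).eventually_const_lt
          (show l < (1 : ℝ) ^ (-ρ) * l + γ₀ by rw [Real.one_rpow]; linarith)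
        obtain ⟨b, hb, hb1⟩ := (h2.and self_mem_nhdsWithin).exists
        have hb1 : 1 < b := hb1
        refine ⟨Set.Ico a₀ b, mem_nhdsWithin_of_mem_nhds (Ico_mem_nhds ha₀' hb1), ?_⟩
        exact eventually_measureReal_div_mem_le h hA0 hind hl hp hq₀ (by linarith) hb le_rfl
      · have hy0 : 0 < y := by linarith
        have hyρ : y ^ (-ρ) < 1 := Real.rpow_lt_one_of_one_lt_of_neg hy1 (neg_lt_zero.2 hρ)
        -- Above 1 the gap between l and l' leaves room for a rate m that suffices at the right
        -- endpoint b and is available at the left endpoint a.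
        obtain ⟨m, hm, hm'⟩ := exists_between
          (show l * (1 - y ^ (-ρ)) < l' * (1 - y ^ (-ρ)) by nlinarith)
        have h1 : ContinuousAt (fun b : ℝ => l * (1 - b ^ (-ρ))) y :=
          ((hcont y hy0).const_sub 1).const_mul l
        have h2 : ContinuousAt (fun b : ℝ => l' * (1 - b ^ (-ρ))) y :=
          ((hcont y hy0).const_sub 1).const_mul l'
        obtain ⟨b, hb, hyb⟩ := (((h1.tendsto.mono_left
          (nhdsWithin_le_nhds (s := Set.Ioi y))).eventually_lt_const hm).and
          self_mem_nhdsWithin).exists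
        obtain ⟨a, ha, hay⟩ := (((h2.tendsto.mono_left
          (nhdsWithin_le_nhds (s := Set.Iio y))).eventually_const_lt hm').and
          (Ioo_mem_nhdsLT hy1)).exists
        have hyb : y < b := hyb
        refine ⟨Set.Ico a b, mem_nhdsWithin_of_mem_nhds (Ico_mem_nhds hay.2 hyb), ?_⟩
        exact eventually_measureReal_div_mem_le h hA0 hind hl hp (hq a hay.1 m ha)
          (by linarith) (by linarith) le_rfl
  have hIci : ∃ μ > l, ∀ᶠ ε in 𝓝[>] (0 : ℝ),
      Q.real {s | X s / ε ∈ Set.Ici M ∧ A s * X s + B s < ε} ≤ Real.exp (-μ * H ε) := by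
    obtain ⟨μ, hμ, hμ'⟩ := exists_between hM
    refine ⟨μ, hμ, ?_⟩
    filter_upwards [self_mem_nhdsWithin, hq M hM1 μ hμ'] with ε hε h1
    exact (measureReal_div_mem_and_affine_lt_le_of_subset_Ici hA0 hε le_rfl).trans h1
  obtain ⟨μ, hμ, hμ'⟩ := eventually_measureReal_div_mem_union_le hρ h hcompact hIci
  refine ⟨μ, hμ, ?_⟩
  filter_upwards [self_mem_nhdsWithin, hμ'] with ε hε h1
  rw [hfix]
  refine le_trans (measureReal_mono_ae ?_) h1
  filter_upwards [hX0] with s hs hs'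
  exact ⟨(le_total (X s / ε) M).imp (fun h => ⟨div_nonneg hs (le_of_lt hε), h⟩) id, hs'⟩

end

/-! ### Limits for probabilities, and the constant λ* -/

lemma tendsto_neg_log_measure_div_iff {S : Type*} [MeasurableSpace S] {Q : Measure S}
    [IsProbabilityMeasure Q] {E : ℝ → Set S} {H : ℝ → ℝ} {l : ℝ≥0∞} {f : Filter ℝ}
    (hH : ∀ᶠ x in f, 0 < H x) :
    Tendsto (fun x => -ENNReal.log (Q (E x)) / (H x : EReal)) f (𝓝 (l : EReal)) ↔
      (∀ γ : ℝ, (γ : EReal) < l → ∀ᶠ x in f, Q.real (E x) ≤ Real.exp (-γ * H x)) ∧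
      (∀ γ : ℝ, (l : EReal) < γ → ∀ᶠ x in f, Real.exp (-γ * H x) ≤ Q.real (E x)) := by
  rw [tendsto_neg_log_div_iff hH]
  simp only [ENNReal.le_ofReal_iff_toReal_le (measure_ne_top Q _) (Real.exp_pos _).le,
    ENNReal.ofReal_le_iff_le_toReal (measure_ne_top Q _), Measure.real]

/-- The weight in λ* is the reciprocal of 1 - y^(-ρ), the factor by which the recursions compare
g(y) with a rate. -/
lemma div_sub_one_mul_one_sub_rpow_neg {ρ y : ℝ} (hρ : 0 < ρ) (hy : 1 < y) :
    0 < y ^ ρ / (y ^ ρ - 1) ∧ y ^ ρ / (y ^ ρ - 1) * (1 - y ^ (-ρ)) = 1 := by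
  have h1 : 1 < y ^ ρ := Real.one_lt_rpow hy hρ
  have h2 : y ^ ρ - 1 ≠ 0 := by linarith
  refine ⟨div_pos (by linarith) (by linarith), ?_⟩
  rw [Real.rpow_neg (by linarith)]
  field_simp

lemma exists_lt_of_lambdaStar_lt {ρ γ : ℝ} {g : ℝ≥0 → ℝ≥0∞} (hρ : 0 < ρ)
    (h : lambdaStar ρ g < ENNReal.ofReal γ) :
    ∃ y : ℝ≥0, 1 < y ∧ g y < ENNReal.ofReal (γ * (1 - (y : ℝ) ^ (-ρ))) := by
  simp only [lambdaStar, iInf_lt_iff] at h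
  obtain ⟨y, hy, h⟩ := h
  refine ⟨y, hy, ?_⟩
  obtain ⟨h1, h2⟩ := div_sub_one_mul_one_sub_rpow_neg hρ (show (1 : ℝ) < y from hy)
  by_contra! hcon
  have h3 := h.trans_le' (mul_le_mul_right hcon _)
  rw [← ENNReal.ofReal_mul h1.le, mul_left_comm, h2, mul_one] at h3
  exact lt_irrefl _ h3

lemma coe_lt_of_lt_mul_of_lt_lambdaStar {ρ l γ : ℝ} {g : ℝ≥0 → ℝ≥0∞} (hρ : 0 < ρ)
    (h : (l : EReal) < lambdaStar ρ g) {y : ℝ≥0} (hy : 1 < y)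
    (hγ : γ < l * (1 - (y : ℝ) ^ (-ρ))) : (γ : EReal) < g y := by
  obtain ⟨h1, h2⟩ := div_sub_one_mul_one_sub_rpow_neg hρ (show (1 : ℝ) < y from hy)
  by_contra! hcon
  have hγ0 : 0 ≤ γ := by
    exact_mod_cast (EReal.coe_ennreal_nonneg (g y)).trans hcon
  have h3 : g y ≤ ENNReal.ofReal γ := by
    rw [← EReal.coe_ennreal_le_coe_ennreal_iff, EReal.coe_ennreal_ofReal, max_eq_left hγ0]
    exact hcon
  have h4 : lambdaStar ρ g ≤ ENNReal.ofReal ((y : ℝ) ^ ρ / ((y : ℝ) ^ ρ - 1) * γ) := by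
    rw [ENNReal.ofReal_mul h1.le]
    exact (iInf₂_le y hy).trans (mul_le_mul_right h3 _)
  have h5 : (y : ℝ) ^ ρ / ((y : ℝ) ^ ρ - 1) * γ < l := by
    have := mul_lt_mul_of_pos_left hγ h1
    rwa [mul_left_comm, h2, mul_one] at this
  rw [← EReal.coe_ennreal_le_coe_ennreal_iff, EReal.coe_ennreal_ofReal,
    max_eq_left (mul_nonneg h1.le hγ0)] at h4
  exact absurd (h.trans_le h4) (not_lt.2 (by exact_mod_cast h5.le))

/-! ### The two bounds for the left tail of X -/

section

variable {S : Type*} [MeasurableSpace S] {Q : Measure S} [IsProbabilityMeasure Q]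
  {X A B : S → ℝ} {H : ℝ → ℝ} {ρ : ℝ}

lemma exists_measureReal_lt_pos (X : S → ℝ) : ∃ ε > 0, 0 < Q.real {s | X s < ε} := by
  have h : Q (⋃ n : ℕ, {s | X s < (n : ℝ) + 1}) ≠ 0 := by
    have : ⋃ n : ℕ, {s | X s < (n : ℝ) + 1} = Set.univ := by
      refine Set.eq_univ_of_forall fun s => Set.mem_iUnion.2 ?_
      obtain ⟨n, hn⟩ := exists_nat_gt (X s)
      exact ⟨n, by simp only [Set.mem_ofPred_eq]; linarith⟩
    rw [this, measure_univ]; exact one_ne_zero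
  obtain ⟨n, hn⟩ := exists_measure_pos_of_not_measure_iUnion_null h
  exact ⟨n + 1, by positivity, ENNReal.toReal_pos hn.ne' (measure_ne_top _ _)⟩

lemma exists_measureReal_lt_lt_one (hB : AEMeasurable B Q) (hB0 : ∀ᵐ s ∂Q, 0 ≤ B s)
    (h : Q {s | B s = 0} < 1) : ∃ ε > 0, Q.real {s | B s < ε} < 1 := by
  by_contra! hcon
  refine h.ne ?_
  have h1 : ∀ n : ℕ, ∀ᵐ s ∂Q, B s < 1 / ((n : ℝ) + 1) := fun n => by
    refine (mem_ae_iff_prob_eq_one₀ (nullMeasurableSet_lt hB aemeasurable_const)).2 ?_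
    have h2 := le_antisymm measureReal_le_one (hcon (1 / ((n : ℝ) + 1)) (by positivity))
    rwa [Measure.real, ENNReal.toReal_eq_one_iff] at h2
  refine (mem_ae_iff_prob_eq_one₀ (nullMeasurableSet_eq_fun hB aemeasurable_const)).1 ?_
  filter_upwards [ae_all_iff.2 h1, hB0] with s hs hs0
  exact le_antisymm (ge_of_tendsto' tendsto_one_div_add_atTop_nhds_zero_nat fun n => (hs n).le) hs0

/-- The event reads B < ε(1 - Ay); as B ≥ 0 and ε > 0 it forces 1 - Ay > 0, so it persists when ε
grows. -/
lemma monotoneOn_measureReal_affine_lt (hB0 : ∀ᵐ s ∂Q, 0 ≤ B s) (y : ℝ) :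
    MonotoneOn (fun ε : ℝ => Q.real {s | ε * A s * y + B s < ε}) (Set.Ioi 0) := by
  intro ε hε δ _ hεδ
  refine measureReal_mono_ae ?_
  filter_upwards [hB0] with s hs h
  have hε : 0 < ε := hε
  have h : ε * A s * y + B s < ε := h
  have h1 : 0 < 1 - A s * y := by
    by_contra! hcon; nlinarith
  show δ * A s * y + B s < δ
  nlinarith [mul_le_mul_of_nonneg_right hεδ h1.le]

/-- The left tail of a solution of `X = A X + B` decays exponentially on the scale `H` as soon as
`B` is not a.s. zero and `ε A y + B < ε` has this property for some `y < 1`. -/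
lemma exists_pos_rate (hρ : 0 < ρ) (h : IsRegularlyVaryingAtZero H (-ρ))
    (hB : AEMeasurable B Q) (hA0 : ∀ᵐ s ∂Q, 0 ≤ A s) (hB0 : ∀ᵐ s ∂Q, 0 ≤ B s)
    (hX0 : ∀ᵐ s ∂Q, 0 ≤ X s) (hind : IndepFun X (fun s => (A s, B s)) Q)
    (hfix : ∀ ε, Q.real {s | X s < ε} = Q.real {s | A s * X s + B s < ε})
    (hBnd : Q {s | B s = 0} < 1) {y γ : ℝ} (hy : 0 < y) (hy1 : y < 1) (hγ : 0 < γ)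
    (hq : ∀ᶠ ε in 𝓝[>] (0 : ℝ), Q.real {s | ε * A s * y + B s < ε} ≤ Real.exp (-γ * H ε)) :
    ∃ μ > 0, ∀ᶠ ε in 𝓝[>] (0 : ℝ), Q.real {s | X s < ε} ≤ Real.exp (-μ * H ε) := by
  obtain ⟨ε₀, hε₀, hc⟩ := exists_measureReal_lt_lt_one hB hB0 hBnd
  -- Splitting at X/ε = y: below, independence leaves B < ε as the second factor, of probability at
  -- most P(B < ε₀) < 1; above, the joint event with parameter y occurs.
  have hrec : ∀ᶠ ε in 𝓝[>] (0 : ℝ), Q.real {s | X s < ε} ≤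
      Q.real {s | B s < ε₀} * Q.real {s | X s < y * ε} + Real.exp (-γ * H ε) := by
    filter_upwards [hq, Ioo_mem_nhdsGT hε₀] with ε h1 hε
    have h2 := measureReal_div_mem_and_affine_lt_le hA0 hind hε.1
      (T := Set.Ico 0 y) (a := 0) (b := y) le_rfl
    have h3 := measureReal_div_mem_and_affine_lt_le_of_subset_Ici (X := X) (B := B) hA0 hε.1
      (T := Set.Ici y) le_rfl
    have h4 : Q.real {s | ε * A s * 0 + B s < ε} ≤ Q.real {s | B s < ε₀} :=
      measureReal_mono fun s hs => by
        have : ε * A s * 0 + B s < ε := hs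
        show B s < ε₀
        linarith [hε.2]
    have h5 : Q.real {s | X s < ε} ≤ Q.real ({s | X s / ε ∈ Set.Ico 0 y ∧ A s * X s + B s < ε} ∪
        {s | X s / ε ∈ Set.Ici y ∧ A s * X s + B s < ε}) := by
      rw [hfix]
      refine measureReal_mono_ae ?_
      filter_upwards [hX0] with s hs hs'
      exact (lt_or_ge (X s / ε) y).imp (fun h => ⟨⟨div_nonneg hs hε.1.le, h⟩, hs'⟩)
        fun h => ⟨h, hs'⟩
    have h6 := h5.trans (measureReal_union_le _ _)
    have h7 := mul_le_mul_of_nonneg_left h4 (measureReal_nonneg (μ := Q) (s := {s | X s < y * ε}))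
    linarith
  have hlast := eventually_le_mul_exp_of_le_add hρ h (fun ε => measureReal_le_one) hy hy1
    measureReal_nonneg hc hγ.le hrec
  refine ⟨γ / 2, by linarith, ?_⟩
  filter_upwards [hlast, h.eventually_mul_exp_le hρ (half_lt_self hγ)
    (1 - Q.real {s | B s < ε₀})⁻¹] with ε h1 h2 using h1.trans h2

/-- If γ < λ* failed to be a rate, the set of rates would be bounded by γ, and its positive supremum
could still be improved. Working with a real l' strictly between γ and λ* covers λ* = ∞. -/
lemma eventually_measureReal_lt_le_exp {g : ℝ≥0 → ℝ≥0∞} (hg : IsLDM Q ρ H A B g)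
    (hX0 : ∀ᵐ s ∂Q, 0 ≤ X s) (hind : IndepFun X (fun s => (A s, B s)) Q)
    (hfix : ∀ ε, Q.real {s | X s < ε} = Q.real {s | A s * X s + B s < ε})
    (hBnd : Q {s | B s = 0} < 1) {y : ℝ≥0} (hy : 0 < y) (hy1 : y < 1) (hgy : 0 < g y) {γ : ℝ}
    (hγ : (γ : EReal) < lambdaStar ρ g) :
    ∀ᶠ ε in 𝓝[>] (0 : ℝ), Q.real {s | X s < ε} ≤ Real.exp (-γ * H ε) := by
  have hρ := hg.rho_pos
  have h := hg.regVar
  have hq : ∀ y : ℝ≥0, ∀ γ : ℝ, (γ : EReal) < g y → ∀ᶠ ε in 𝓝[>] (0 : ℝ),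
      Q.real {s | ε * A s * y + B s < ε} ≤ Real.exp (-γ * H ε) := fun y =>
    ((tendsto_neg_log_measure_div_iff h.eventually_pos).1 (hg.tendsto_joint y)).1
  obtain ⟨γ₀, hγ₀, hγ₀'⟩ := EReal.lt_iff_exists_real_btwn.1
    (show (0 : EReal) < g y by exact_mod_cast hgy)
  have hγ₀ : 0 < γ₀ := by exact_mod_cast hγ₀
  by_contra hcon
  set R : Set ℝ := {γ | ∀ᶠ ε in 𝓝[>] (0 : ℝ), Q.real {s | X s < ε} ≤ Real.exp (-γ * H ε)} with hR
  have hdown : ∀ γ ∈ R, ∀ γ' ≤ γ, γ' ∈ R := by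
    intro γ hγ γ' hle
    filter_upwards [hγ, h.eventually_pos] with ε h1 h2
    exact h1.trans (Real.exp_le_exp.2 (by nlinarith))
  have hRle : ∀ γ' ∈ R, γ' ≤ γ := fun γ' hγ' => by
    by_contra! hlt
    exact hcon (hdown γ' hγ' γ hlt.le)
  have hbdd : BddAbove R := ⟨γ, hRle⟩
  obtain ⟨μ₀, hμ₀, hμ₀R⟩ := exists_pos_rate hρ h hg.aemeasurable_B hg.nonneg_A hg.nonneg_B hX0 hind
    hfix hBnd (show (0 : ℝ) < y from hy) (show (y : ℝ) < 1 from hy1) hγ₀ (hq y γ₀ hγ₀')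
  have hμ₀R : μ₀ ∈ R := hμ₀R
  obtain ⟨l', hl', hl''⟩ := EReal.lt_iff_exists_real_btwn.1 hγ
  have hl' : γ < l' := by exact_mod_cast hl'
  obtain ⟨μ, hμ, hμR⟩ := exists_rate_gt hρ h hg.nonneg_A hX0 hind hfix (l := sSup R) (l' := l')
    (hμ₀.trans_le (le_csSup hbdd hμ₀R)) ((csSup_le ⟨μ₀, hμ₀R⟩ hRle).trans_lt hl')
    (fun γ' hγ' => by
      obtain ⟨ν, hν, hν'⟩ := exists_lt_of_lt_csSup ⟨μ₀, hμ₀R⟩ hγ'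
      exact hdown ν hν γ' hν'.le)
    (fun a ha γ' hγ' => by
      lift a to ℝ≥0 using by linarith
      exact hq a γ' (coe_lt_of_lt_mul_of_lt_lambdaStar hρ hl'' (by exact_mod_cast ha) hγ'))
    (show (0 : ℝ) < y from hy) (show (y : ℝ) < 1 from hy1) hγ₀ (hq y γ₀ hγ₀')
  exact absurd (le_csSup hbdd hμR) (not_le.2 hμ)

lemma eventually_exp_le_measureReal_lt {g : ℝ≥0 → ℝ≥0∞} (hg : IsLDM Q ρ H A B g)
    (hind : IndepFun X (fun s => (A s, B s)) Q)
    (hfix : ∀ ε, Q.real {s | X s < ε} = Q.real {s | A s * X s + B s < ε}) {γ : ℝ}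
    (hγ : (lambdaStar ρ g : EReal) < γ) :
    ∀ᶠ ε in 𝓝[>] (0 : ℝ), Real.exp (-γ * H ε) ≤ Q.real {s | X s < ε} := by
  have hρ := hg.rho_pos
  have h := hg.regVar
  -- The iteration runs at γ₁ < γ so that its constant `K` can be absorbed at the end.
  obtain ⟨γ₁, hγ₁, hγ₁'⟩ := EReal.lt_iff_exists_real_btwn.1 hγ
  have hγ₁' : γ₁ < γ := by exact_mod_cast hγ₁'
  have hγ₁0 : 0 < γ₁ := by
    exact_mod_cast (EReal.coe_ennreal_nonneg (lambdaStar ρ g)).trans_lt hγ₁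
  obtain ⟨y, hy, hgy⟩ := exists_lt_of_lambdaStar_lt (γ := γ₁) hρ (by
    rwa [← EReal.coe_ennreal_lt_coe_ennreal_iff, EReal.coe_ennreal_ofReal, max_eq_left hγ₁0.le])
  have hy1 : (1 : ℝ) < y := hy
  have hyρ : (y : ℝ) ^ (-ρ) < 1 := Real.rpow_lt_one_of_one_lt_of_neg hy1 (neg_lt_zero.2 hρ)
  rw [← EReal.coe_ennreal_lt_coe_ennreal_iff, EReal.coe_ennreal_ofReal,
    max_eq_left (mul_nonneg hγ₁0.le (by linarith))] at hgy
  obtain ⟨γ', hγ', hγ''⟩ := EReal.lt_iff_exists_real_btwn.1 hgy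
  have hγ'' : γ' < γ₁ * (1 - (y : ℝ) ^ (-ρ)) := by exact_mod_cast hγ''
  have hq := ((tendsto_neg_log_measure_div_iff h.eventually_pos).1 (hg.tendsto_joint y)).2 γ' hγ'
  -- This c turns γ₁ c + γ' ≤ γ₁ into an equality; c > y^(-ρ) is the strict inequality γ' < γ₁(1 -
  -- y^(-ρ)).
  obtain ⟨K, hK, hKp⟩ := exists_mul_exp_le_of_mul_le (p := fun ε => Q.real {s | X s < ε})
    (c := 1 - γ' / γ₁) h
    (fun ε δ hεδ => measureReal_mono fun s (hs : X s < ε) => hs.trans_le hεδ)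
    (monotoneOn_measureReal_affine_lt hg.nonneg_B y) (exists_measureReal_lt_pos X) hy1
    (fun ε _ => (mul_le_measureReal_affine_lt hg.nonneg_A hind y ε).trans_eq (hfix ε).symm)
    hq hγ₁0.le
    (by
      have : γ' / γ₁ < 1 - (y : ℝ) ^ (-ρ) := by rw [div_lt_iff₀ hγ₁0]; linarith
      linarith)
    (by rw [mul_sub, mul_div_cancel₀ _ hγ₁0.ne']; linarith)
  filter_upwards [hKp, h.eventually_mul_exp_le hρ hγ₁' K⁻¹] with ε h1 h2
  refine le_trans ?_ h1
  rwa [inv_mul_le_iff₀ hK] at h2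

end

/-! ### Transfer to a common probability space and conclusion -/

/-- The local dependence measure depends only on the joint law of `(A, B)`. -/
lemma IsLDM.of_identDistrib {Ω S : Type*} [MeasurableSpace Ω] [MeasurableSpace S] {P : Measure Ω}
    {Q : Measure S} {ρ : ℝ} {H : ℝ → ℝ} {A B : Ω → ℝ} {A' B' : S → ℝ} {g : ℝ≥0 → ℝ≥0∞}
    (hg : IsLDM P ρ H A B g)
    (h : IdentDistrib (fun ω => (A ω, B ω)) (fun s => (A' s, B' s)) P Q) :
    IsLDM Q ρ H A' B' g where
  rho_pos := hg.rho_pos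
  regVar := hg.regVar
  aemeasurable_A := h.aemeasurable_snd.fst
  aemeasurable_B := h.aemeasurable_snd.snd
  nonneg_A := h.ae_snd (p := fun z => 0 ≤ z.1) (measurableSet_le (by fun_prop) (by fun_prop))
    hg.nonneg_A
  nonneg_B := h.ae_snd (p := fun z => 0 ≤ z.2) (measurableSet_le (by fun_prop) (by fun_prop))
    hg.nonneg_B
  tendsto_joint y := by
    refine (hg.tendsto_joint y).congr fun ε => ?_
    have : P {ω | ε * A ω * (y : ℝ) + B ω < ε} = Q {s | ε * A' s * (y : ℝ) + B' s < ε} :=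
      h.measure_mem_eq (s := {z : ℝ × ℝ | ε * z.1 * (y : ℝ) + z.2 < ε})
        (measurableSet_lt (by fun_prop) (by fun_prop))
    rw [this]

theorem mainTheorem2 {Ω Ω' : Type*} [MeasurableSpace Ω] [MeasurableSpace Ω']
    (P : Measure Ω) [IsProbabilityMeasure P] (P' : Measure Ω') [IsProbabilityMeasure P']
    (ρ : ℝ) (H : ℝ → ℝ) (A B : Ω → ℝ) (g : ℝ≥0 → ℝ≥0∞)
    (hg : IsLDM P ρ H A B g)
    (hnd : lambdaStar ρ g = 0 ∨
      (P {ω | B ω = 0} < 1 ∧ ∃ y : ℝ≥0, 0 < y ∧ y < 1 ∧ 0 < g y))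
    (X : Ω' → ℝ) (hX : IsSolutionSFPE P A B P' X) (hX0 : ∀ᵐ ω ∂P', 0 ≤ X ω) :
    IsIED P' ρ H (lambdaStar ρ g) X := by
  obtain ⟨S, _, Q, X₁, A₁, B₁, _, hXid, hABid, hind, hfix⟩ := hX
  have hgQ := hg.of_identDistrib hABid.symm
  have hX₁0 : ∀ᵐ s ∂Q, 0 ≤ X₁ s := hXid.symm.ae_snd (p := fun x => 0 ≤ x) measurableSet_Ici hX0
  have hfix' : ∀ ε, Q.real {s | X₁ s < ε} = Q.real {s | A₁ s * X₁ s + B₁ s < ε} := fun ε =>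
    congrArg ENNReal.toReal (hfix.measure_mem_eq (measurableSet_Iio (a := ε)))
  refine ⟨hg.rho_pos, hg.regVar, hXid.aemeasurable_snd, hX0, ?_⟩
  have hP' : ∀ ε, P' {ω | X ω < ε} = Q {s | X₁ s < ε} := fun ε =>
    (hXid.measure_mem_eq (measurableSet_Iio (a := ε))).symm
  simp only [hP']
  refine (tendsto_neg_log_measure_div_iff hg.regVar.eventually_pos).2
    ⟨fun γ hγ => ?_, fun γ hγ => eventually_exp_le_measureReal_lt hgQ hind hfix' hγ⟩
  rcases hnd with h0 | ⟨hBnd, y, hy, hy1, hgy⟩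
  · have hγ0 : γ < 0 := by rw [h0, EReal.coe_ennreal_zero] at hγ; exact_mod_cast hγ
    filter_upwards [hg.regVar.eventually_pos] with ε hε
    exact measureReal_le_one.trans (Real.one_le_exp (by nlinarith))
  · have hBQ : Q {s | B₁ s = 0} < 1 := by
      refine lt_of_eq_of_lt ?_ hBnd
      exact hABid.measure_mem_eq (s := {z : ℝ × ℝ | z.2 = 0})
        (measurableSet_eq_fun (by fun_prop) (by fun_prop))
    exact eventually_measureReal_lt_le_exp hgQ hX₁0 hind hfix' hBQ hy hy1 hgy hγ
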